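/- Let $A$ and $B$ be finite alphabets, $A\neq\emptyset$. A \emph{cellular automaton transducer} (CAT) consists of a finite nonempty state set $S\supseteq A$, a set $F\subseteq S$ of accepting states, a boundary symbol $\#\notin S$, and a local transition function $\delta\colon (S\cup\{\#\})\times S\times(S\cup\{\#\})\to S\times(B^*\cup\{\bot\})$. On input $w=a_1\cdots a_n\in A^+$ it works on cells $1,\dots,n$; at time $0$ cell $i$ is in state $a_i$ and its output register is empty ($\bot$). In every time step all cells simultaneously apply $\delta$ to the states of their left neighbour, of themselves and of their right neighbour ($\#$ for a missing neighbour); the first component is the next state, and the second component is stored in the output register if that is still empty (a filled register is never changed). A pair $(w,v)\in A^+\times B^*$ belongs to the transduction $T(M)$ of the CAT $M$ if the leftmost cell is in an accepting state at some time and at some time all output registers are filled and $v$ is the concatenation of their contents from left to right. $M$ has time complexity $(t_i,t_o)$ if for all $(w,v)\in T(M)$ the leftmost cell is in an accepting state at some time $\le t_i(|w|)$ and all output registers are filled after at most $t_o(|w|)$ steps. An \emph{iterative array transducer} (IAT) consists of a finite state set $S$, a set $F\subseteq S$ of accepting states, a quiescent state $s_0\in S$, an end-of-input symbol $\triangleleft\notin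 A$, a total function $\delta\colon S^3\to S$ with $\delta(s_0,s_0,s_0)=s_0$, and a partial function $\delta_0\colon(A\cup\{\triangleleft\})\times S^2\to B^*\times S$. It works on cells $0,1,2,\dots$, all in state $s_0$ at time $0$. In step $t$ the communication cell $0$ reads the $t$-th input symbol ($\triangleleft$ if $t>|w|$) and applies $\delta_0$ to it, to its own state and to the state of cell $1$, which gives an emitted word and its next state; simultaneously all other cells apply $\delta$ to the states of their left neighbour, of themselves and of their right neighbour. The IAT halts when $\delta_0$ is undefined. A pair $(w,v)\in A^+\times B^*$ belongs to the transduction $T(M)$ of the IAT $M$ if cell $0$ is in an accepting state at some time during the computation on $w$, the computation halts, and $v$ is the concatenation of all emitted words. $M$ has time complexity $(t_i,t_o)$ if for all $(w,v)\in T(M)$ cell $0$ is in an accepting state at some time $\le t_i(|w|)$ and $M$ halts after at most $t_o(|w|)$ steps. \textbf{Theorem.} Let $t_i,t_o\colon\mathbb N\to\mathbb N$ be two mappings such that $t_i(n)\le k_1\cdot n$ and $t_o(n)\le k_2\cdot n$ for all $n\ge1$, for two constants $1\le k_1,k_2$, and such that $n\le t_o(n)$ for all $n$. Then every transduction $T\subseteq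 A^+\times B^*$ that is computed by some IAT of time complexity $(t_i,t_o)$ is also computed by some CAT of time complexity $(t_i,t_o)$. -/

import Mathlib

/-- A (two-way, one-dimensional) cellular automaton transducer with input alphabet `A` and
output alphabet `B`. The input symbols are particular states (via `input`).
In the arguments of `δ` (left neighbour, cell itself, right neighbour), `none` is the boundary
symbol `#`; in the second component of its value, `none` is `⊥` (nothing is emitted). -/
structure CAT (A B : Type*) where
  State : Type
  finite_state : Finite State
  nonempty_state : Nonempty State
  accepting : Set State
  input : A ↪ State
  δ : Option State → State → Option State → State × Option (List B)

namespace CAT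

variable {A B : Type*}

/-- A configuration on `n` cells: the state of every cell and the content of its output
register, where `none` is `⊥` (no output so far). -/
structure Config (M : CAT A B) (n : ℕ) where
  state : Fin n → M.State
  output : Fin n → Option (List B)

/-- The state of the left neighbour of cell `i`, or the boundary symbol `none`. -/
def leftNbr (M : CAT A B) {n : ℕ} (c : Fin n → M.State) (i : Fin n) : Option M.State :=
  if i.val = 0 then none else some (c ⟨i.val - 1, by omega⟩)

/-- The state of the right neighbour of cell `i`, or the boundary symbol `none`. -/
def rightNbr (M : CAT A B) {n : ℕ} (c : Fin n → M.State) (i : Fin n) : Option M.State :=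
  if h : i.val + 1 < n then some (c ⟨i.val + 1, h⟩) else none

/-- The global transition function: all cells apply `δ` simultaneously, and an output register
that has been filled keeps its content for ever. -/
def step (M : CAT A B) {n : ℕ} (C : M.Config n) : M.Config n where
  state i := (M.δ (M.leftNbr C.state i) (C.state i) (M.rightNbr C.state i)).1
  output i :=
    match C.output i with
    | some v => some v
    | none => (M.δ (M.leftNbr C.state i) (C.state i) (M.rightNbr C.state i)).2

/-- The initial configuration: cell `i` carries the `i`-th input symbol, no outputs. -/
def init (M : CAT A B) (w : List A) : M.Config w.length where
  state i := M.input (w.get i)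
  output _ := none

/-- The configuration at time `t` on input `w`. -/
def config (M : CAT A B) (w : List A) (t : ℕ) : M.Config w.length :=
  M.step^[t] (M.init w)

/-- The leftmost cell is in an accepting state at time `t`. -/
def AcceptsAt (M : CAT A B) (w : List A) (t : ℕ) : Prop :=
  ∃ h : 0 < w.length, (M.config w t).state ⟨0, h⟩ ∈ M.accepting

/-- At time `t` all output registers are filled, and `v` is the concatenation of their
contents from left to right. -/
def OutputsAt (M : CAT A B) (w : List A) (t : ℕ) (v : List B) : Prop :=
  ∃ o : Fin w.length → List B,
    (∀ i, (M.config w t).output i = some (o i)) ∧ v = (List.ofFn o).flatten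

/-- The transduction `T(M) ⊆ A⁺ × B*` realized by `M`. -/
def transduction (M : CAT A B) : Set (List A × List B) :=
  {p | p.1 ≠ [] ∧ (∃ t, M.AcceptsAt p.1 t) ∧ ∃ t, M.OutputsAt p.1 t p.2}

/-- `M` is of time complexity `(ti, tout)`. -/
def HasTimeComplexity (M : CAT A B) (ti tout : ℕ → ℕ) : Prop :=
  ∀ w v, (w, v) ∈ M.transduction →
    (∃ t ≤ ti w.length, M.AcceptsAt w t) ∧
    ∃ t ≤ tout w.length, ∀ i, (M.config w t).output i ≠ none

/-- The family of transductions (from words over `A` to words over `B`) that are realized by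
cellular automaton transducers of time complexity `(ti, tout)`. -/
def family (A B : Type*) (ti tout : ℕ → ℕ) : Set (Set (List A × List B)) :=
  {T | ∃ M : CAT A B, M.HasTimeComplexity ti tout ∧ M.transduction = T}

end CAT

/-- An iterative array transducer with input alphabet `A` and output alphabet `B`.
In the first argument of `δ₀`, `none` is the end-of-input symbol; the other two arguments are
the states of the communication cell and of its right neighbour. The function `δ₀` is partial:
the value `none` means that it is undefined. The arguments of `δ` are the states of the left
neighbour, the cell itself, and the right neighbour. -/
structure IAT (A B : Type*) where
  State : Type
  finite_state : Finite State
  accepting : Set State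
  quiescent : State
  δ : State → State → State → State
  δ_quiescent : δ quiescent quiescent quiescent = quiescent
  δ₀ : Option A → State → State → Option (List B × State)

namespace IAT

variable {A B : Type*}

/-- One step of the array with input symbol `x` (or end-of-input `none`). The states of the
cells are given by `c : ℕ → M.State`, where cell `0` is the communication cell. The result is
the emitted word and the next states, or `none` if the array halts. -/
def step (M : IAT A B) (x : Option A) (c : ℕ → M.State) : Option (List B × (ℕ → M.State)) :=
  (M.δ₀ x (c 0) (c 1)).map fun r =>
    (r.1, fun
      | 0 => r.2
      | j + 1 => M.δ (c j) (c (j + 1)) (c (j + 2)))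

/-- The states of all cells and the total output emitted so far after `t` steps on input `w`;
it is `none` if the array has halted before performing `t` steps. The symbol read in step
`t + 1` is `w[t]?`, the end-of-input symbol `none` once the input is consumed. -/
def run (M : IAT A B) (w : List A) : ℕ → Option ((ℕ → M.State) × List B)
  | 0 => some (fun _ => M.quiescent, [])
  | t + 1 => (run M w t).bind fun p => (M.step w[t]? p.1).map fun r => (r.2, p.2 ++ r.1)

/-- The computation reaches time `t`, where the communication cell is in an accepting state. -/
def AcceptsAt (M : IAT A B) (w : List A) (t : ℕ) : Prop :=
  ∃ c v, M.run w t = some (c, v) ∧ c 0 ∈ M.accepting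

/-- The array halts after exactly `t` steps, with total output `v`. -/
def HaltsAt (M : IAT A B) (w : List A) (t : ℕ) (v : List B) : Prop :=
  ∃ c, M.run w t = some (c, v) ∧ M.δ₀ w[t]? (c 0) (c 1) = none

/-- The transduction `T(M) ⊆ A⁺ × B*` computed by `M` (as for cellular automaton transducers,
the empty input word is disregarded). -/
def transduction (M : IAT A B) : Set (List A × List B) :=
  {p | p.1 ≠ [] ∧ (∃ t, M.AcceptsAt p.1 t) ∧ ∃ t, M.HaltsAt p.1 t p.2}

/-- `M` is of time complexity `(ti, tout)`: every successfully transformed input `w` is accepted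
after at most `ti |w|` steps, and its output is completed, that is, the array halts, after at
most `tout |w|` steps. -/
def HasTimeComplexity (M : IAT A B) (ti tout : ℕ → ℕ) : Prop :=
  ∀ w v, (w, v) ∈ M.transduction →
    (∃ t ≤ ti w.length, M.AcceptsAt w t) ∧ ∃ t ≤ tout w.length, M.HaltsAt w t v

/-- The family of transductions (from words over `A` to words over `B`) that are computed by
iterative array transducers of time complexity `(ti, tout)`. -/
def family (A B : Type*) (ti tout : ℕ → ℕ) : Set (Set (List A × List B)) :=
  {T | ∃ M : IAT A B, M.HasTimeComplexity ti tout ∧ M.transduction = T}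

end IAT

/-! A direct simulation with the communication cell in cell `0` gives acceptance in real time. But
each transducer cell emits only once, so the output must be spread over the cells in time. The
simulation is therefore skewed: cell `i` at time `t` treats array time `i + t`, in step with the
input shifting left. Its window of `k + 3` array positions advances one position per step, and
position `0` is read off in cell `i` for `k * i ≤ t ≤ k * i + k`. These readings travel left at unit
speed and stay current, because a right neighbour is one array step ahead. So with `n = w.length`,
array time `s` is known in cell `i` at time `s - i` when `(k + 1) * i ≤ s < (k + 1) * n`, and cell
`0` accepts in real time.

Cell `i` is assigned the `i`-th block of `(k + 1)²` emissions, so the cells with `(k + 1) * i < n`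
already cover all `(k + 1) * n` relevant steps. If the array halts at time `T`, cells with `(k + 1)
* i ≤ n` know it by time `max T n`; the remaining cells have empty blocks and see the end of the
input by time `n`. Finally `n ≤ tout n` gives `max T n ≤ tout n`.

`cell_succ` shows that these data obey a local rule, `CAT.exists_of_local_rule` makes it a
transducer, and `flatten_blockWord` and `exists_outputReady` give the output and its timing. -/

/-! ### Transducers from local rules. -/

/-- A family of cells that is governed by a local rule from time `1` on, where the states at time
`1` may depend on the input symbols of both neighbours, is realized by a transducer. -/
theorem CAT.exists_of_local_rule {A B Q : Type*} [Finite A] [Nonempty A] [Finite Q]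
    (start : Option A → A → Option A → Q) (next : Option Q → Q → Option Q → Q)
    (acc₀ : Prop) (acc : Set Q) (out : Q → Option (List B)) (cell : List A → ℕ → ℕ → Q)
    (hstart : ∀ w i (h : i < w.length),
      cell w 1 i = start (if i = 0 then none else w[i - 1]?) w[i] w[i + 1]?)
    (hnext : ∀ w t i, 1 ≤ t → i < w.length →
      cell w (t + 1) i = next (if i = 0 then none else some (cell w t (i - 1))) (cell w t i)
        (if i + 1 < w.length then some (cell w t (i + 1)) else none)) :
    ∃ M : CAT A B, (∀ w, M.AcceptsAt w 0 ↔ w ≠ [] ∧ acc₀) ∧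
      (∀ w t, 1 ≤ t → (M.AcceptsAt w t ↔ w ≠ [] ∧ cell w t 0 ∈ acc)) ∧
      (∀ w i, (M.config w 0).output i = none) ∧
      ∀ w t i, (M.config w (t + 1)).output i =
        ((M.config w t).output i).or (out (cell w (t + 1) i)) := by
  -- States are inputs at time `0` and elements of `Q` afterwards; passing to `Fin N` puts the state
  -- set into `Type`.
  obtain ⟨N, ⟨e⟩⟩ := Finite.exists_equiv_fin (A ⊕ Q)
  let M : CAT A B :=
    { State := Fin N
      finite_state := inferInstance
      nonempty_state := ⟨e (.inl (Classical.arbitrary A))⟩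
      accepting := {s | (∃ a, e.symm s = .inl a ∧ acc₀) ∨ ∃ q ∈ acc, e.symm s = .inr q}
      input := ⟨fun a => e (.inl a), fun a b h => by simpa using h⟩
      δ := fun l c r =>
        let q := match e.symm c with
          | .inl a => start (l.bind fun s => (e.symm s).getLeft?) a
              (r.bind fun s => (e.symm s).getLeft?)
          | .inr q => next (l.bind fun s => (e.symm s).getRight?) q
              (r.bind fun s => (e.symm s).getRight?)
        (e (.inr q), out q) }
  have hinit : ∀ w, ∀ i : Fin w.length, (M.config w 0).state i = e (.inl (w.get i)) :=
    fun _ _ => rfl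
  have hδ0 : ∀ w i, M.δ (M.leftNbr (M.config w 0).state i) ((M.config w 0).state i)
      (M.rightNbr (M.config w 0).state i) = (e (.inr (cell w 1 i)), out (cell w 1 i)) := by
    intro w i
    have key : start
        ((M.leftNbr (M.config w 0).state i).bind fun s => (e.symm s).getLeft?) (w.get i)
        ((M.rightNbr (M.config w 0).state i).bind fun s => (e.symm s).getLeft?) = cell w 1 i := by
      rw [hstart w i i.2]
      congr 1
      · unfold CAT.leftNbr
        split_ifs with h
        · rfl
        · have : (i : ℕ) - 1 < w.length := by omega
          simp [hinit, this]
      · unfold CAT.rightNbr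
        split_ifs with h
        · simp [hinit, h]
        · simp at h
          simp [h]
    have hst : e.symm ((M.config w 0).state i) = .inl (w.get i) := by
      rw [hinit]; exact e.symm_apply_apply _
    simp only [M] at hst key ⊢
    rw [hst, ← key]
  have hδ : ∀ w t, 1 ≤ t → (∀ j : Fin w.length, (M.config w t).state j = e (.inr (cell w t j))) →
      ∀ i : Fin w.length, M.δ (M.leftNbr (M.config w t).state i) ((M.config w t).state i)
      (M.rightNbr (M.config w t).state i) =
        (e (.inr (cell w (t + 1) i)), out (cell w (t + 1) i)) := by
    intro w t ht hc i
    have key : next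
        ((M.leftNbr (M.config w t).state i).bind fun s => (e.symm s).getRight?) (cell w t i)
        ((M.rightNbr (M.config w t).state i).bind fun s => (e.symm s).getRight?) =
          cell w (t + 1) i := by
      rw [hnext w t i ht i.2]
      congr 1
      · unfold CAT.leftNbr
        split_ifs with h
        · rfl
        · simp [hc]
      · unfold CAT.rightNbr
        split_ifs with h
        · simp [hc]
        · rfl
    have hst : e.symm ((M.config w t).state i) = .inr (cell w t i) := by
      rw [hc]; exact e.symm_apply_apply _
    simp only [M] at hst key ⊢
    rw [hst, ← key]
  have hsucc : ∀ w t, M.config w (t + 1) = M.step (M.config w t) := fun w t =>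
    Function.iterate_succ_apply' _ _ _
  have hstate : ∀ w t, ∀ i : Fin w.length,
      (M.config w (t + 1)).state i = e (.inr (cell w (t + 1) i)) := by
    intro w t
    induction t with
    | zero => intro i; rw [hsucc]; exact congrArg Prod.fst (hδ0 w i)
    | succ t ih => intro i; rw [hsucc]; exact congrArg Prod.fst (hδ w _ (by omega) ih i)
  have hδ' : ∀ w t, ∀ i : Fin w.length,
      (M.δ (M.leftNbr (M.config w t).state i) ((M.config w t).state i)
      (M.rightNbr (M.config w t).state i)).2 = out (cell w (t + 1) i) := by
    intro w t i
    cases t with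
    | zero => exact congrArg Prod.snd (hδ0 w i)
    | succ t => exact congrArg Prod.snd (hδ w _ (by omega) (hstate w t) i)
  refine ⟨M, fun w => ?_, fun w t ht => ?_, fun w i => rfl, fun w t i => ?_⟩
  · constructor
    · rintro ⟨h, hs⟩
      refine ⟨List.ne_nil_of_length_pos h, ?_⟩
      rw [hinit] at hs
      simpa [M] using hs
    · rintro ⟨h, h0⟩
      refine ⟨List.length_pos_of_ne_nil h, ?_⟩
      rw [hinit]
      simpa [M] using h0
  · obtain ⟨t, rfl⟩ := Nat.exists_eq_add_of_le' ht
    constructor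
    · rintro ⟨h, hs⟩
      refine ⟨List.ne_nil_of_length_pos h, ?_⟩
      rw [hstate] at hs
      simpa [M] using hs
    · rintro ⟨h, h0⟩
      refine ⟨List.length_pos_of_ne_nil h, ?_⟩
      rw [hstate]
      simpa [M] using h0
  · rw [hsucc, ← hδ' w t i]
    simp only [CAT.step]
    cases (M.config w t).output i <;> rfl

/-! ### Space-time diagram of the array on a two-sided line. -/

namespace IAT

variable {A B : Type*} (M : IAT A B)

/-- The content of a position of the two-sided line: `none` outside the array, `some none` if
the content is undefined because the array has halted. -/
abbrev Slot : Type := Option (Option M.State)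

/-- The local rule of the array on slots; the communication cell is the one whose left neighbour
lies outside the array. -/
def rule (x : Option A) (l c r : M.Slot) : M.Slot :=
  match l, c, r with
  | _, none, _ => none
  | none, some (some c), some (some r) => some ((M.δ₀ x c r).map Prod.snd)
  | some (some l), some (some c), some (some r) => some (some (M.δ l c r))
  | _, some _, _ => some none

/-- The slot at position `j` after `s` steps on input `w`. -/
def trace (w : List A) : ℕ → ℤ → M.Slot
  | 0, j => if j < 0 then none else some (some M.quiescent)
  | s + 1, j => M.rule w[s]? (trace w s (j - 1)) (trace w s j) (trace w s (j + 1))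

/-- The word emitted by the communication cell, `none` if the array halts or has halted. -/
def emit (x : Option A) (c r : M.Slot) : Option (List B) :=
  match c, r with
  | some (some c), some (some r) => (M.δ₀ x c r).map Prod.fst
  | _, _ => none

/-- The word emitted in step `s + 1` on input `w`. -/
def emission (w : List A) (s : ℕ) : Option (List B) :=
  M.emit w[s]? (M.trace w s 0) (M.trace w s 1)

variable {M} {w : List A}

theorem rule_isSome (x : Option A) (l c r : M.Slot) : (M.rule x l c r).isSome = c.isSome := by
  unfold rule
  split <;> rfl

theorem trace_eq_none_iff (s : ℕ) (j : ℤ) : M.trace w s j = none ↔ j < 0 := by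
  induction s generalizing j with
  | zero => simp [trace]
  | succ s ih =>
    rw [← ih j, ← Option.not_isSome_iff_eq_none, trace, rule_isSome,
      Option.not_isSome_iff_eq_none]

/-- Light cone: activity starts at position `0` and spreads by one position per step. -/
theorem trace_of_le (s : ℕ) (j : ℤ) (h : (s : ℤ) ≤ j) :
    M.trace w s j = some (some M.quiescent) := by
  induction s generalizing j with
  | zero => simp [trace]; omega
  | succ s ih =>
    rw [trace, ih _ (by omega), ih _ (by omega), ih _ (by omega)]
    simp [rule, M.δ_quiescent]

theorem run_some {s : ℕ} {c : ℕ → M.State} {v : List B} (h : M.run w s = some (c, v)) :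
    (∀ j : ℕ, M.trace w s j = some (some (c j))) ∧
      v = ((List.range s).map fun t => (M.emission w t).getD []).flatten := by
  induction s generalizing c v with
  | zero =>
    simp only [run, Option.some.injEq, Prod.mk.injEq] at h
    obtain ⟨rfl, rfl⟩ := h
    exact ⟨fun j => trace_of_le 0 _ (by simp), by simp⟩
  | succ s ih =>
    simp only [run, Option.bind_eq_some_iff, step, Option.map_map, Option.map_eq_some_iff] at h
    obtain ⟨⟨c', v'⟩, hr, ⟨o, q⟩, hδ, he⟩ := h
    obtain ⟨hc, hv⟩ := ih hr
    simp only [Function.comp, Prod.mk.injEq] at he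
    obtain ⟨rfl, rfl⟩ := he
    have h0 := hc 0
    have h1 := hc 1
    simp only [Nat.cast_zero, Nat.cast_one] at h0 h1
    have hn : M.trace w s (-1) = none := (trace_eq_none_iff _ _).2 (by simp)
    refine ⟨fun j => ?_, ?_⟩
    · cases j with
      | zero => simp [trace, h0, h1, hn, rule, hδ]
      | succ j =>
        have e1 : ((j + 1 : ℕ) : ℤ) - 1 = (j : ℕ) := by simp
        have e2 : ((j + 1 : ℕ) : ℤ) + 1 = (j + 2 : ℕ) := by push_cast; ring
        rw [trace, e1, e2, hc, hc, hc]
        rfl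
    · have : M.emission w s = some o := by simp [emission, h0, h1, emit, hδ]
      simp [List.range_succ, ← hv, this]

theorem run_none {s : ℕ} (h : M.run w s = none) :
    M.trace w s 0 = some none ∧ ∃ T < s, ∃ v, M.HaltsAt w T v := by
  induction s with
  | zero => simp [run] at h
  | succ s ih =>
    cases hr : M.run w s with
    | none =>
      obtain ⟨h0, T, hT, v, hv⟩ := ih hr
      exact ⟨by simp [trace, h0, rule], T, by omega, v, hv⟩
    | some p =>
      obtain ⟨c, v⟩ := p
      simp only [run, hr, Option.bind_some, step, Option.map_map, Option.map_eq_none_iff] at h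
      obtain ⟨hc, -⟩ := run_some hr
      have h0 := hc 0
      have h1 := hc 1
      simp only [Nat.cast_zero, Nat.cast_one] at h0 h1
      have hn : M.trace w s (-1) = none := (trace_eq_none_iff _ _).2 (by simp)
      exact ⟨by simp [trace, h0, h1, hn, rule, h], s, by omega, v, c, hr, h⟩

theorem acceptsAt_iff {t : ℕ} :
    M.AcceptsAt w t ↔ ∃ q ∈ M.accepting, M.trace w t 0 = some (some q) := by
  constructor
  · rintro ⟨c, v, hr, hc⟩
    exact ⟨c 0, hc, (run_some hr).1 0⟩
  · rintro ⟨q, hq, h⟩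
    cases hr : M.run w t with
    | none => simp [(run_none hr).1] at h
    | some p =>
      refine ⟨p.1, p.2, hr, ?_⟩
      have := (run_some hr).1 0
      simp only [Nat.cast_zero, h, Option.some.injEq] at this
      exact this ▸ hq

/-- With `HaltsAt.emission_eq_none`, this turns halting into a test on the next symbol and two
slots, which a single cell can perform. -/
theorem exists_haltsAt_of_emission_eq_none {s : ℕ} (h : M.emission w s = none) :
    ∃ T ≤ s, ∃ v, M.HaltsAt w T v := by
  cases hr : M.run w s with
  | none =>
    obtain ⟨T, hT, hv⟩ := (run_none hr).2
    exact ⟨T, hT.le, hv⟩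
  | some p =>
    have h0 := (run_some hr).1 0
    have h1 := (run_some hr).1 1
    simp only [Nat.cast_zero, Nat.cast_one] at h0 h1
    refine ⟨s, le_rfl, p.2, p.1, hr, ?_⟩
    simpa [emission, h0, h1, emit] using h

theorem HaltsAt.emission_eq_none {T s : ℕ} {v : List B} (h : M.HaltsAt w T v) (hs : T ≤ s) :
    M.emission w s = none := by
  obtain ⟨c, hr, hδ⟩ := h
  obtain rfl | hlt := hs.eq_or_lt
  · have h0 := (run_some hr).1 0
    have h1 := (run_some hr).1 1
    simp only [Nat.cast_zero, Nat.cast_one] at h0 h1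
    simp [emission, h0, h1, emit, hδ]
  · have hn : M.run w s = none := by
      obtain ⟨d, rfl⟩ := Nat.exists_eq_add_of_lt hlt
      clear hs hlt
      induction d with
      | zero => simp [run, hr, step, hδ]
      | succ d ih =>
        change (M.run w (T + d + 1)).bind _ = none
        rw [ih]
        rfl
    simp [emission, (run_none hn).1, emit]

theorem HaltsAt.output_eq {T : ℕ} {v : List B} (h : M.HaltsAt w T v) :
    v = ((List.range T).map fun t => (M.emission w t).getD []).flatten := by
  obtain ⟨c, hr, -⟩ := h
  exact (run_some hr).2

end IAT

/-! ### The simulating cells and their local rule. -/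

namespace IAT

variable {A B : Type*} (M : IAT A B) (k : ℕ)

/-- The states of the transducer that simulates an array. In the cell `i` at time `t`, the entries
belong to the array at time `i + t`: the next input symbol, a window of slots that moves to the
right along the array, the first two slots of the array if they are known, and the block of
data that determines the part of the output assigned to the cell. -/
structure Cell where
  symbol : Option A
  window : Fin (k + 3) → M.Slot
  comm : Option (M.Slot × M.Slot)
  buffer : Fin ((k + 1) * (k + 1)) → Option (Option A × M.Slot × M.Slot)

instance [Finite A] : Finite (M.Cell k) := by
  have := M.finite_state
  refine Finite.of_injective (fun c : M.Cell k => (c.symbol, c.window, c.comm, c.buffer)) ?_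
  rintro ⟨⟩ ⟨⟩ h
  simpa using h

variable {M k}

namespace Cell

/-- The window, continued by `none`. -/
def slot (C : M.Cell k) (r : ℕ) : M.Slot :=
  if h : r < k + 3 then C.window ⟨r, h⟩ else none

/-- The window after one step of a cell and its left neighbour. -/
def nextWindow (L : Option (M.Cell k)) (C : M.Cell k) (r : Fin (k + 3)) : M.Slot :=
  if 2 ≤ r.val then M.rule C.symbol (C.slot r) (C.slot (r - 1)) (C.slot (r - 2))
  else match L with
    | none => some (some M.quiescent)
    | some D => M.rule C.symbol
        (M.rule D.symbol (D.slot (k + 1 + r)) (D.slot (k + r)) (D.slot (k + r - 1)))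
        (M.rule D.symbol (D.slot (k + r)) (D.slot (k + r - 1)) (D.slot (k + r - 2)))
        (M.rule D.symbol (D.slot (k + r - 1)) (D.slot (k + r - 2)) (D.slot (k + r - 3)))

open scoped Classical in
/-- The first two slots of the array, taken from the own window or from the right neighbour. -/
noncomputable def nextComm (W : Fin (k + 3) → M.Slot) (R : Option (M.Cell k)) :
    Option (M.Slot × M.Slot) :=
  if h : ∃ r : Fin (k + 1), W ⟨r + 1, by omega⟩ ≠ none ∧ W ⟨r + 2, by omega⟩ = none then
    some (W ⟨h.choose + 1, by omega⟩, W ⟨h.choose, by omega⟩)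
  else R.bind comm

open scoped Classical in
/-- The block after one step of a cell and its left neighbour. -/
noncomputable def nextBuffer (L : Option (M.Cell k)) (C : M.Cell k)
    (r : Fin ((k + 1) * (k + 1))) : Option (Option A × M.Slot × M.Slot) :=
  (C.buffer r).or <|
    if (r.val = 0 ∧ ∃ D ∈ L, D.buffer ⟨(k + 1) * (k + 1) - 2, by simp⟩ ≠ none) ∨
      (r.val ≠ 0 ∧ C.buffer ⟨r - 1, by omega⟩ ≠ none)
    then C.comm.map (Prod.mk C.symbol) else none

/-- The local rule of the simulating transducer. -/
noncomputable def next (L : Option (M.Cell k)) (C : M.Cell k) (R : Option (M.Cell k)) :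
    M.Cell k where
  symbol := R.bind symbol
  window := nextWindow L C
  comm := nextComm (nextWindow L C) R
  buffer := nextBuffer L C

/-- The state at time `1`, depending on the input symbols of the cell and its neighbours. -/
def start (l : Option A) (a : A) (r : Option A) : M.Cell k :=
  let W : ℕ → M.Slot := fun r => M.trace [a] 1 (2 - r)
  match l with
  | none => ⟨r, fun r => W r, some (W 2, W 1),
      fun r => if r.val = 0 then some (some a, M.trace [a] 0 0, M.trace [a] 0 1) else none⟩
  | some _ => ⟨r, fun _ => none, none, fun _ => none⟩

/-- The word determined by the block of a cell. -/
def word (C : M.Cell k) : List B :=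
  (List.ofFn fun r => ((C.buffer r).bind fun y => M.emit y.1 y.2.1 y.2.2).getD []).flatten

open scoped Classical in
/-- The output of a cell: it is emitted as soon as the array is known to have halted, or if the end
of the input is known before the first two slots of the array. -/
noncomputable def output (C : M.Cell k) : Option (List B) :=
  if (C.slot 1 = none ∧ C.symbol = none) ∨ ∃ p ∈ C.comm, M.emit C.symbol p.1 p.2 = none then
    some C.word
  else none

end Cell

variable (M k) in
/-- The state of cell `i` at time `t` of the transducer that simulates `M` on input `w`. -/
def cell (w : List A) (t i : ℕ) : M.Cell k where
  symbol := w[i + t]?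
  window r := M.trace w (i + t) (t + 1 - k * i - r)
  comm := if k * i ≤ t ∧ i + t < (k + 1) * w.length then
    some (M.trace w (i + t) 0, M.trace w (i + t) 1) else none
  buffer r :=
    let s := (k + 1) * (k + 1) * i + r
    if s < i + t ∧ s < (k + 1) * w.length then
      some (w[s]?, M.trace w s 0, M.trace w s 1) else none

variable {w : List A} {t i : ℕ}

theorem slot_cell {r : ℕ} (h : r < k + 3) :
    (M.cell k w t i).slot r = M.trace w (i + t) (t + 1 - k * i - r) := by
  simp [Cell.slot, h, cell]

theorem trace_one_congr {a : A} {l : List A} (j : ℤ) :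
    M.trace (a :: l) 1 j = M.trace [a] 1 j := by
  simp [trace]

/-- Since `3 ≤ k`, the windows of the cells `i ≥ 1` still lie left of the array at time `1`. Cell
`0` has made one array step, which depends only on the first symbol. -/
theorem cell_one (hk : 3 ≤ k) (h : i < w.length) :
    M.cell k w 1 i = Cell.start (if i = 0 then none else w[i - 1]?) w[i] w[i + 1]? := by
  obtain _ | i := i
  · obtain _ | ⟨a, l⟩ := w
    · simp at h
    have h1 : 1 < (k + 1) * (l.length + 1) := by nlinarith
    simp only [cell, Cell.start, if_true, Cell.mk.injEq]
    refine ⟨by simp, ?_, ?_, ?_⟩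
    · funext r
      simp only [zero_add, trace_one_congr]
      congr 1
    · simp [h1, trace_one_congr]
    · funext r
      by_cases hr : r.val = 0
      · simp [hr, trace]
      · simp [hr]
  · have hi : w[i]? = some w[i] := List.getElem?_eq_getElem (by omega)
    have h2 : 3 * (i + 1) ≤ k * (i + 1) := Nat.mul_le_mul_right _ hk
    have h3 : 16 * (i + 1) ≤ (k + 1) * (k + 1) * (i + 1) :=
      Nat.mul_le_mul_right _ (Nat.mul_le_mul (by omega) (by omega) : 4 * 4 ≤ _)
    simp only [cell, Cell.start, Nat.add_one_ne_zero, if_false, Nat.add_sub_cancel, hi,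
      Cell.mk.injEq]
    refine ⟨trivial, ?_, ?_, ?_⟩
    · funext r
      rw [trace_eq_none_iff]
      push_cast
      have : (3 * (i + 1) : ℤ) ≤ k * (i + 1) := by exact_mod_cast h2
      omega
    · rw [if_neg]
      omega
    · funext r
      rw [if_neg]
      omega

/-- All but the two front entries have their neighbourhood in the old window. For those two, the
left neighbour, one array step behind, supplies five slots to which the rule is applied twice; `3 ≤
k` keeps the least index `k + r - 3` from being truncated. -/
theorem nextWindow_cell (hk : 3 ≤ k) (r : Fin (k + 3)) :
    Cell.nextWindow (if i = 0 then none else some (M.cell k w t (i - 1))) (M.cell k w t i) r =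
      M.trace w (i + t + 1) (t + 2 - k * i - r) := by
  have hr := r.2
  have hs : ∀ (i n : ℕ) (j : ℤ), n < k + 3 → (t + 1 - k * i - n : ℤ) = j →
      (M.cell k w t i).slot n = M.trace w (i + t) j := by
    rintro i n j h rfl
    exact slot_cell h
  unfold Cell.nextWindow
  split_ifs with h2 hi
  · rw [trace, hs i r (t + 2 - k * i - r - 1), hs i (r - 1) (t + 2 - k * i - r),
      hs i (r - 2) (t + 2 - k * i - r + 1)]
    · rfl
    all_goals omega
  · subst hi
    -- The front of the window of cell `0` is outside the light cone.
    rw [trace_of_le]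
    push_cast
    omega
  · obtain ⟨i, rfl⟩ := Nat.exists_eq_succ_of_ne_zero hi
    obtain ⟨k, rfl⟩ := Nat.exists_eq_add_of_le' hk
    obtain ⟨r, hr'⟩ := r
    simp only at hr h2 ⊢
    obtain ⟨u, hu⟩ : ∃ u : ℤ, u = (t + 2 - ((k + 3 : ℕ) : ℤ) * ((i + 1 : ℕ) : ℤ) - r : ℤ) :=
      ⟨_, rfl⟩
    have hu' : (t + 2 - ((k + 3 : ℕ) : ℤ) * i - r : ℤ) = u + k + 3 := by
      rw [hu]; push_cast; ring
    simp only [Nat.succ_eq_add_one, Nat.add_sub_cancel]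
    rw [← hu, hs i _ (u - 2), hs i _ (u - 1), hs i _ u, hs i _ (u + 1), hs i _ (u + 2)]
    · rw [show i + 1 + t + 1 = i + t + 1 + 1 by ring, trace, trace, trace, trace]
      simp only [cell, show i + 1 + t = i + t + 1 by ring]
      ring_nf
    all_goals omega

/-- Position `0` is the last slot before the `none` entries. Once it has left the window, the right
neighbour's pair belongs to exactly the array time needed. -/
theorem nextComm_cell (hk : 3 ≤ k) (h : i < w.length) :
    Cell.nextComm (M.cell k w (t + 1) i).window
      (if i + 1 < w.length then some (M.cell k w t (i + 1)) else none) =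
        (M.cell k w (t + 1) i).comm := by
  have hlen : (k + 1) * (i + 1) ≤ (k + 1) * w.length := Nat.mul_le_mul_left _ h
  have e1 : (k + 1) * (i + 1) = k * i + k + i + 1 := by ring
  have e2 : k * (i + 1) = k * i + k := by ring
  have key : ∀ r : Fin (k + 1), (M.cell k w (t + 1) i).window ⟨r + 1, by omega⟩ ≠ none →
      (M.cell k w (t + 1) i).window ⟨r + 2, by omega⟩ = none →
      some ((M.cell k w (t + 1) i).window ⟨r + 1, by omega⟩,
        (M.cell k w (t + 1) i).window ⟨r, by omega⟩) = (M.cell k w (t + 1) i).comm := by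
    intro r h1 h2
    have h3 := r.2
    simp only [cell, ne_eq, trace_eq_none_iff] at h1 h2 ⊢
    push_cast at h1 h2 ⊢
    have h4 : ((k * i : ℕ) : ℤ) = k * i := by push_cast; rfl
    rw [if_pos (by omega), show (t + 1 + 1 - k * i - (r + 1) : ℤ) = 0 by omega,
      show (t + 1 + 1 - k * i - r : ℤ) = 1 by omega]
  unfold Cell.nextComm
  split_ifs with hW hi
  · exact key _ hW.choose_spec.1 hW.choose_spec.2
  · have hW' : t + 1 < k * i ∨ k * i + k ≤ t := by
      by_contra! hcon
      refine hW ⟨⟨t + 1 - k * i, by omega⟩, ?_⟩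
      have h4 : ((k * i : ℕ) : ℤ) = k * i := by push_cast; rfl
      simp only [cell, ne_eq, trace_eq_none_iff]
      push_cast
      omega
    simp only [cell, Option.bind_some, show i + 1 + t = i + (t + 1) by ring]
    split_ifs <;> first | rfl | omega
  · have hW' : t + 1 < k * i ∨ k * i + k ≤ t := by
      by_contra! hcon
      refine hW ⟨⟨t + 1 - k * i, by omega⟩, ?_⟩
      have h4 : ((k * i : ℕ) : ℤ) = k * i := by push_cast; rfl
      simp only [cell, ne_eq, trace_eq_none_iff]
      push_cast
      omega
    -- The cutoff `(k + 1) * w.length` is the array time at which the last cell can no longer read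
    -- position `0`.
    have e3 : w.length = i + 1 := by omega
    rw [e3] at hlen
    simp only [cell, Option.bind_none, e3]
    rw [if_neg (by omega)]

theorem buffer_cell_ne_none (r : Fin ((k + 1) * (k + 1))) :
    (M.cell k w t i).buffer r ≠ none ↔
      (k + 1) * (k + 1) * i + r < i + t ∧ (k + 1) * (k + 1) * i + r < (k + 1) * w.length := by
  simp [cell]

/-- Entries are filled in order, so a filled predecessor signals that the next one is due. Across
cells the signal is the last but one entry, because the left neighbour lags one array step. -/
theorem nextBuffer_cell (ht : 1 ≤ t) (hk : 3 ≤ k)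
    (r : Fin ((k + 1) * (k + 1))) :
    Cell.nextBuffer (if i = 0 then none else some (M.cell k w t (i - 1))) (M.cell k w t i) r =
      (M.cell k w (t + 1) i).buffer r := by
  have hr := r.2
  have hD : 16 ≤ (k + 1) * (k + 1) := (Nat.mul_le_mul (by omega) (by omega) : 4 * 4 ≤ _)
  have hki : k * i + i ≤ (k + 1) * (k + 1) * i := by
    calc k * i + i = (k + 1) * 1 * i := by ring
      _ ≤ _ := Nat.mul_le_mul_right _ (Nat.mul_le_mul_left _ (by omega))
  have hd0 : i = 0 → (k + 1) * (k + 1) * i = 0 := by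
    rintro rfl
    rfl
  have hL : (∃ D ∈ (if i = 0 then none else some (M.cell k w t (i - 1))),
      D.buffer ⟨(k + 1) * (k + 1) - 2, by omega⟩ ≠ none) ↔
        i ≠ 0 ∧ (k + 1) * (k + 1) * i < i + t + 1 ∧
          (k + 1) * (k + 1) * i < (k + 1) * w.length + 2 := by
    split_ifs with hi
    · simp [hi]
    · have hDi : (k + 1) * (k + 1) * (i - 1) + (k + 1) * (k + 1) = (k + 1) * (k + 1) * i := by
        obtain ⟨i, rfl⟩ := Nat.exists_eq_succ_of_ne_zero hi
        simp only [Nat.succ_eq_add_one, Nat.add_sub_cancel]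
        ring
      simp only [Option.mem_some_iff, exists_eq_left', buffer_cell_ne_none]
      omega
  simp only [Cell.nextBuffer, hL, buffer_cell_ne_none]
  simp only [cell]
  generalize (k + 1) * (k + 1) * i = d at *
  generalize (k + 1) * w.length = m at *
  by_cases h1 : d + r.val < i + t ∧ d + r.val < m
  · rw [if_pos h1, if_pos (c := _ ∧ _) (by omega : d + r.val < i + (t + 1) ∧ d + r.val < m)]
    rfl
  rw [if_neg h1, Option.none_or]
  by_cases h2 : d + r.val = i + t ∧ d + r.val < m
  · rw [if_pos (by omega), if_pos (by omega), if_pos (by omega), h2.1]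
    rfl
  · rw [if_neg (c := d + r.val < i + (t + 1) ∧ _) (by omega)]
    split_ifs with h3 h4
    · omega
    · rfl
    · rfl

theorem cell_succ (hk : 3 ≤ k) (ht : 1 ≤ t) (h : i < w.length) :
    M.cell k w (t + 1) i = Cell.next (if i = 0 then none else some (M.cell k w t (i - 1)))
      (M.cell k w t i) (if i + 1 < w.length then some (M.cell k w t (i + 1)) else none) := by
  have hW : Cell.nextWindow (if i = 0 then none else some (M.cell k w t (i - 1)))
      (M.cell k w t i) = (M.cell k w (t + 1) i).window := by
    funext r
    rw [nextWindow_cell hk, cell, ← add_assoc]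
    congr 1
  rw [Cell.next, hW, nextComm_cell hk h]
  change Cell.mk _ _ _ _ = Cell.mk _ _ _ _
  rw [Cell.mk.injEq]
  refine ⟨?_, rfl, rfl, funext fun r => (nextBuffer_cell ht hk r).symm⟩
  split_ifs with hi
  · simp [cell, add_assoc, add_comm 1]
  · simp
    omega

end IAT

/-! ### Output, halting and time bounds. -/

namespace IAT

variable {A B : Type*} (M : IAT A B) (k : ℕ)

/-- The part of the output on `w` that is assigned to cell `i`. -/
def blockWord (w : List A) (i : ℕ) : List B :=
  (List.ofFn fun r : Fin ((k + 1) * (k + 1)) =>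
    if (k + 1) * (k + 1) * i + r < (k + 1) * w.length then
      (M.emission w ((k + 1) * (k + 1) * i + r)).getD [] else []).flatten

/-- The condition under which cell `i` emits its output in step `t`. -/
def OutputReady (w : List A) (t i : ℕ) : Prop :=
  (t < k * i ∧ w.length ≤ i + t) ∨
    (k * i ≤ t ∧ i + t < (k + 1) * w.length ∧ M.emission w (i + t) = none)

variable {M k} {w : List A} {t i : ℕ}

theorem emission_eq_none_of_le {s s' : ℕ} (h : M.emission w s = none) (hs : s ≤ s') :
    M.emission w s' = none := by
  obtain ⟨T, hT, v, hv⟩ := exists_haltsAt_of_emission_eq_none h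
  exact hv.emission_eq_none (hT.trans hs)

theorem word_cell (h : M.OutputReady k w t i) : (M.cell k w t i).word = M.blockWord k w i := by
  unfold Cell.word blockWord
  congr 2
  funext r
  have hb : ((M.cell k w t i).buffer r).bind (fun y => M.emit y.1 y.2.1 y.2.2) =
      if (k + 1) * (k + 1) * i + r < i + t ∧ (k + 1) * (k + 1) * i + r < (k + 1) * w.length then
        M.emission w ((k + 1) * (k + 1) * i + r) else none := by
    simp only [cell]
    split_ifs <;> rfl
  rw [hb]
  obtain ⟨h1, h2⟩ | ⟨h1, h2, h3⟩ := h
  -- From `w.length ≤ i + t < (k + 1) * i`: the block starts beyond the cutoff, so it is empty.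
  · have : (k + 1) * w.length ≤ (k + 1) * (k + 1) * i := by
      rw [mul_assoc]
      exact Nat.mul_le_mul_left _ (by rw [add_mul]; omega)
    rw [if_neg (by omega), if_neg (by omega)]
    rfl
  · split_ifs with h4 h5 h5
    · rfl
    · omega
    · rw [emission_eq_none_of_le h3 (by omega)]
    · rfl

open scoped Classical in
theorem output_cell (hk : 3 ≤ k) :
    (M.cell k w t i).output = if M.OutputReady k w t i then some (M.blockWord k w i) else none := by
  have h : (((M.cell k w t i).slot 1 = none ∧ (M.cell k w t i).symbol = none) ∨
      ∃ p ∈ (M.cell k w t i).comm, M.emit (M.cell k w t i).symbol p.1 p.2 = none) ↔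
        M.OutputReady k w t i := by
    have h4 : ((k * i : ℕ) : ℤ) = k * i := by push_cast; rfl
    rw [slot_cell (by omega), trace_eq_none_iff]
    unfold OutputReady
    refine or_congr (and_congr (by push_cast; omega) ?_) ?_
    · simp [cell]
    · simp [cell, emission, and_assoc]
  unfold Cell.output
  simp only [h]
  split_ifs with h'
  · rw [word_cell h']
  · rfl

/-- The blocks list the emissions in order beyond time `T`; everything from `T` on contributes the
empty word. -/
theorem flatten_blockWord {T : ℕ} {v : List B} (h : M.HaltsAt w T v)
    (hT : T ≤ (k + 1) * w.length) :
    (List.ofFn fun i : Fin w.length => M.blockWord k w i).flatten = v := by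
  let g : ℕ → List B := fun s =>
    if s < (k + 1) * w.length then (M.emission w s).getD [] else []
  have hle : (k + 1) * w.length ≤ w.length * ((k + 1) * (k + 1)) := by
    nlinarith [Nat.zero_le (k * (k + 1) * w.length)]
  have h1 : (List.ofFn fun i : Fin w.length => M.blockWord k w i).flatten =
      ((List.range (w.length * ((k + 1) * (k + 1)))).map g).flatten := by
    have h0 : (List.range (w.length * ((k + 1) * (k + 1)))).map g =
        List.ofFn fun s : Fin (w.length * ((k + 1) * (k + 1))) => g s :=
      List.ext_getElem (by simp) (by simp)
    rw [h0, List.ofFn_mul, List.flatten_flatten, List.map_ofFn]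
    congr 2
    funext i
    simp only [blockWord, Function.comp, g, mul_comm i.val]
  rw [h1, h.output_eq]
  obtain ⟨d, hd⟩ := Nat.exists_eq_add_of_le (hT.trans hle)
  rw [hd, List.range_add, List.map_append, List.flatten_append]
  have h2 : (List.map g (List.map (fun x => T + x) (List.range d))).flatten = [] := by
    rw [List.flatten_eq_nil_iff]
    intro l hl
    simp only [List.map_map, List.mem_map, List.mem_range, Function.comp] at hl
    obtain ⟨x, -, rfl⟩ := hl
    simp [g, h.emission_eq_none (Nat.le_add_right T x)]
  rw [h2, List.append_nil]
  congr 1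
  refine List.map_congr_left fun s hs => ?_
  rw [List.mem_range] at hs
  simp only [g]
  rw [if_pos (by omega)]

theorem exists_outputReady {T : ℕ} {v : List B} (hk : 3 ≤ k) (h : M.HaltsAt w T v)
    (hT : T ≤ k * w.length) (hi : i < w.length) :
    ∃ t, 1 ≤ t ∧ t ≤ max T w.length ∧ M.OutputReady k w t i := by
  have hkn : 3 * w.length ≤ k * w.length := Nat.mul_le_mul_right _ hk
  have e1 : (k + 1) * w.length = k * w.length + w.length := by ring
  -- Does the end of the input reach cell `i` before the communication cell is known there, at time
  -- `k * i`?
  by_cases hr : w.length < k * i + i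
  · exact ⟨w.length - i, by omega, by omega, .inl ⟨by omega, by omega⟩⟩
  -- The halt is visible from time `T - i`, but not before `k * i`; no register is filled at time
  -- `0`.
  · exact ⟨max (max (T - i) (k * i)) 1, by omega, by omega,
      .inr ⟨by omega, by omega, h.emission_eq_none (by omega)⟩⟩

theorem mem_family_of_le [Finite A] [Nonempty A] {ti tout : ℕ → ℕ} (hk : 3 ≤ k)
    (hti : ∀ n, 1 ≤ n → ti n ≤ k * n) (htout : ∀ n, 1 ≤ n → tout n ≤ k * n)
    (htout_ge : ∀ n, n ≤ tout n) (hM : M.HasTimeComplexity ti tout) :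
    M.transduction ∈ CAT.family A B ti tout := by
  classical
  obtain ⟨N, hacc0, hacc, hout0, hout⟩ := CAT.exists_of_local_rule Cell.start Cell.next
    (M.quiescent ∈ M.accepting) {C | ∃ q ∈ M.accepting, ∃ y, C.comm = some (some (some q), y)}
    Cell.output (M.cell k) (fun _ _ h => cell_one hk h) (fun _ _ _ ht h => cell_succ hk ht h)
  have hpos : ∀ {w : List A}, w ≠ [] → 1 ≤ w.length := List.length_pos_of_ne_nil
  have hlt : ∀ {w : List A}, w ≠ [] → k * w.length < (k + 1) * w.length := fun hw => by
    have := hpos hw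
    rw [add_mul]
    omega
  have haccept : ∀ w t, N.AcceptsAt w t → M.AcceptsAt w t := by
    intro w t h
    rw [acceptsAt_iff]
    obtain rfl | ht := t.eq_zero_or_pos
    · exact ⟨_, ((hacc0 w).1 h).2, rfl⟩
    · obtain ⟨-, q, hq, y, hy⟩ := (hacc w t ht).1 h
      refine ⟨q, hq, ?_⟩
      simp only [cell, zero_add, Option.ite_none_right_eq_some, Option.some.injEq,
        Prod.mk.injEq] at hy
      exact hy.2.1
  have haccept' : ∀ w t, w ≠ [] → t < (k + 1) * w.length → M.AcceptsAt w t → N.AcceptsAt w t := by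
    intro w t hw hlt h
    obtain ⟨q, hq, htr⟩ := acceptsAt_iff.1 h
    obtain rfl | ht := t.eq_zero_or_pos
    · refine (hacc0 w).2 ⟨hw, ?_⟩
      obtain rfl : M.quiescent = q := by simpa [trace] using htr
      exact hq
    · refine (hacc w t ht).2 ⟨hw, q, hq, M.trace w t 1, ?_⟩
      simp [cell, hlt, htr]
  have hready : ∀ w t, ∀ i : Fin w.length, ∀ o, (N.config w t).output i = some o →
      o = M.blockWord k w i ∧ ∃ s, M.OutputReady k w s i := by
    intro w t i o h
    induction t with
    | zero => simp [hout0] at h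
    | succ t ih =>
      rw [hout, Option.or_eq_some_iff] at h
      obtain h | ⟨-, h⟩ := h
      · exact ih h
      · rw [output_cell hk, Option.ite_none_right_eq_some] at h
        exact ⟨(Option.some.inj h.2).symm, _, h.1⟩
  have hfilled : ∀ w s, ∀ i : Fin w.length, 1 ≤ s → M.OutputReady k w s i → ∀ t, s ≤ t →
      (N.config w t).output i ≠ none := by
    intro w s i hs h t hst
    induction t, hst using Nat.le_induction with
    | base =>
      obtain ⟨s, rfl⟩ := Nat.exists_eq_add_of_le' hs
      rw [hout, output_cell hk, if_pos h]
      simp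
    | succ t _ ih =>
      rw [hout]
      simp [ih]
  have hhalt : ∀ {w v T}, w ≠ [] → M.HaltsAt w T v → T ≤ k * w.length →
      ∀ i : Fin w.length, (N.config w (max T w.length)).output i ≠ none := by
    intro w v T hw h hT i
    obtain ⟨t, ht, htT, hr⟩ := exists_outputReady hk h hT i.2
    exact hfilled w t i ht hr _ htT
  have heq : N.transduction = M.transduction := by
    ext ⟨w, v⟩
    constructor
    · rintro ⟨hw, ⟨t, ht⟩, t', o, ho, hv⟩
      simp only at hw ht ho hv
      have ho' : o = fun i : Fin w.length => M.blockWord k w i :=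
        funext fun i => (hready w t' i _ (ho i)).1
      -- Cell `0` can emit only after detecting a halt, as `s < k * 0` is impossible; its output
      -- thus certifies that the array halts.
      obtain ⟨s, hs⟩ := (hready w t' ⟨0, hpos hw⟩ _ (ho _)).2
      obtain ⟨hs, -⟩ | ⟨-, hs, hem⟩ := hs
      · simp at hs
      obtain ⟨T, hT, v', hv'⟩ := exists_haltsAt_of_emission_eq_none hem
      have := flatten_blockWord (k := k) hv' (by simp only at hT hs; omega)
      rw [hv, ho', this]
      exact ⟨hw, ⟨t, haccept w t ht⟩, T, hv'⟩
    · intro hmem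
      obtain ⟨hw, -, -⟩ := id hmem
      obtain ⟨⟨t, ht, hat⟩, T, hT, hhT⟩ := hM w v hmem
      simp only at hw
      have hTk := hT.trans (htout _ (hpos hw))
      refine ⟨hw, ⟨t, haccept' w t hw ((ht.trans (hti _ (hpos hw))).trans_lt (hlt hw)) hat⟩,
        max T w.length, fun i : Fin w.length => M.blockWord k w i, fun i => ?_, ?_⟩
      · obtain ⟨o, ho⟩ := Option.ne_none_iff_exists'.1 (hhalt hw hhT hTk i)
        rw [ho, (hready w _ i o ho).1]
      · exact (flatten_blockWord hhT (hTk.trans (hlt hw).le)).symm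
  refine ⟨N, fun w v hmem => ?_, heq⟩
  rw [heq] at hmem
  obtain ⟨hw, -, -⟩ := id hmem
  obtain ⟨⟨t, ht, hat⟩, T, hT, hhT⟩ := hM w v hmem
  exact ⟨⟨t, ht, haccept' w t hw ((ht.trans (hti _ (hpos hw))).trans_lt (hlt hw)) hat⟩,
    max T w.length, max_le hT (htout_ge _), hhalt hw hhT (hT.trans (htout _ (hpos hw)))⟩

end IAT

theorem mainTheorem1 {A B : Type*} [Finite A] [Nonempty A] [Finite B]
    (ti tout : ℕ → ℕ) (k₁ k₂ : ℝ) (hk₁ : 1 ≤ k₁) (hk₂ : 1 ≤ k₂)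
    (hti : ∀ n : ℕ, 1 ≤ n → (ti n : ℝ) ≤ k₁ * n)
    (htout : ∀ n : ℕ, 1 ≤ n → (tout n : ℝ) ≤ k₂ * n)
    (htout_ge : ∀ n : ℕ, n ≤ tout n) :
    IAT.family A B ti tout ⊆ CAT.family A B ti tout := by
  rintro _ ⟨M, hM, rfl⟩
  have bound : ∀ {f : ℕ → ℕ} {c : ℝ} {k : ℕ}, (∀ n : ℕ, 1 ≤ n → (f n : ℝ) ≤ c * n) → c ≤ k →
      ∀ n, 1 ≤ n → f n ≤ k * n := by
    intro f c k hf hc n hn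
    have := (hf n hn).trans (mul_le_mul_of_nonneg_right hc (Nat.cast_nonneg n))
    exact_mod_cast this
  refine IAT.mem_family_of_le (k := max 3 (max ⌈k₁⌉₊ ⌈k₂⌉₊)) (le_max_left _ _)
    (bound hti ((Nat.le_ceil k₁).trans ?_)) (bound htout ((Nat.le_ceil k₂).trans ?_)) htout_ge hM
  · exact_mod_cast (le_max_left _ _).trans (le_max_right _ _)
  · exact_mod_cast (le_max_right _ _).trans (le_max_right _ _)
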